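/- Klein's inequality. Let $\mathcal H$ be a complex Hilbert space of arbitrary (finite or infinite) dimension and let $\rho,\sigma$ be density operators on $\mathcal H$, i.e. positive bounded operators of trace $1$. Let $P_r$ and $Q_s$ denote the orthogonal projections onto the eigenspaces $\ker(\rho-r)$ and $\ker(\sigma-s)$, so that $\rho=\sum_r r\,P_r$ and $\sigma=\sum_s s\,Q_s$. For a positive trace-class operator $A$ put $$\operatorname{Tr}(A\log\sigma)=\sum_s \log(s)\,\operatorname{Tr}(Q_sAQ_s)\in[-\infty,0],\qquad \log 0=-\infty,\quad (-\infty)\cdot 0=0,$$ and similarly with $\rho$ in place of $\sigma$. Define the relative entropy by $$S(\rho\|\sigma)=\operatorname{Tr}(\rho\log\rho)-\operatorname{Tr}(\rho\log\sigma)\in[-\infty,\infty]$$ whenever the two traces are not both $-\infty$; if both are $-\infty$, let $S(\rho\|\sigma)$ be the trace of $\rho\log\rho-\rho\log\sigma$ taken along the eigenspaces of $\rho$, that is $$S(\rho\|\sigma)=\sum_r\bigl[\operatorname{Tr}(P_r\rho P_r\log\rho)-\operatorname{Tr}(P_r\rho P_r\log\sigma)\bigr].$$ Then, for all density operators $\rho,\sigma$,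 the negative parts of the terms of the last series have a finite sum (so that the series has a well-defined value in $(-\infty,\infty]$), and $$S(\rho\|\sigma)\ge 0 .$$ -/

import Mathlib

open scoped ENNReal InnerProductSpace

set_option linter.unusedSectionVars false

noncomputable section

namespace QuantumEntropy

variable {H : Type*} [NormedAddCommGroup H] [InnerProductSpace ℂ H] [CompleteSpace H]

/-- The trace in `[0, ∞]` of a positive bounded operator: the sum of the diagonal matrix elements
`⟪b, T b⟫` over an orthonormal Hilbert basis of `H`. For positive `T` the value does not depend on
the basis, see `posTrace_eq`. -/
def posTrace (T : H →L[ℂ] H) : ℝ≥0∞ :=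
  ∑' b : (exists_hilbertBasis ℂ H).choose,
    ENNReal.ofReal (RCLike.re ⟪(b : H), T (b : H)⟫_ℂ)

/-- Parseval's identity in `[0, ∞]`. -/
theorem parseval_ennreal {κ : Type*} (d : HilbertBasis κ ℂ H) (x : H) :
    ENNReal.ofReal (‖x‖ ^ 2) = ∑' k, ENNReal.ofReal (‖⟪d k, x⟫_ℂ‖ ^ 2) := by
  have h' : HasSum (fun k => ‖⟪d k, x⟫_ℂ‖ ^ 2) (‖x‖ ^ 2) := by
    rw [← Complex.hasSum_ofReal]
    have h := d.hasSum_inner_mul_inner x x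
    have h1 : (fun k => ((‖⟪d k, x⟫_ℂ‖ ^ 2 : ℝ) : ℂ)) = fun k => ⟪x, d k⟫_ℂ * ⟪d k, x⟫_ℂ := by
      funext k
      rw [← inner_conj_symm x (d k), Complex.ofReal_pow]
      exact (RCLike.conj_mul (K := ℂ) _).symm
    have h2 : ((‖x‖ ^ 2 : ℝ) : ℂ) = ⟪x, x⟫_ℂ := by
      rw [inner_self_eq_norm_sq_to_K, Complex.ofReal_pow]
      rfl
    rw [h1, h2]
    exact h
  rw [← h'.tsum_eq, ENNReal.ofReal_tsum_of_nonneg (fun _ => by positivity) h'.summable]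

/-- The trace of a positive operator may be computed in every Hilbert basis. -/
theorem posTrace_eq {ι : Type*} (b : HilbertBasis ι ℂ H) {T : H →L[ℂ] H} (hT : T.IsPositive) :
    posTrace T = ∑' i, ENNReal.ofReal (RCLike.re ⟪b i, T (b i)⟫_ℂ) := by
  obtain ⟨c, hc⟩ := (exists_hilbertBasis ℂ H).choose_spec
  have hT0 : 0 ≤ T := (ContinuousLinearMap.nonneg_iff_isPositive T).2 hT
  have hS : (CFC.sqrt T).IsPositive :=
    (ContinuousLinearMap.nonneg_iff_isPositive _).1 (CFC.sqrt_nonneg T)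
  have hmul : CFC.sqrt T * CFC.sqrt T = T := CFC.sqrt_mul_sqrt_self T hT0
  have hsymm : ∀ x y, ⟪CFC.sqrt T x, y⟫_ℂ = ⟪x, CFC.sqrt T y⟫_ℂ :=
    fun x y => hS.inner_left_eq_inner_right x y
  have hdiag : ∀ x, RCLike.re ⟪x, T x⟫_ℂ = ‖CFC.sqrt T x‖ ^ 2 := by
    intro x
    conv_lhs => rw [← hmul]
    rw [mul_apply_eq_comp, ← hsymm, inner_self_eq_norm_sq]
  unfold posTrace
  simp only [hdiag]
  calc ∑' k : (exists_hilbertBasis ℂ H).choose, ENNReal.ofReal (‖CFC.sqrt T (k : H)‖ ^ 2)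
      = ∑' k, ∑' i, ENNReal.ofReal (‖⟪b i, CFC.sqrt T (c k)⟫_ℂ‖ ^ 2) := by
        refine tsum_congr fun k => ?_
        rw [parseval_ennreal b, hc]
    _ = ∑' i, ∑' k, ENNReal.ofReal (‖⟪b i, CFC.sqrt T (c k)⟫_ℂ‖ ^ 2) := ENNReal.tsum_comm
    _ = ∑' i, ENNReal.ofReal (‖CFC.sqrt T (b i)‖ ^ 2) := by
        refine tsum_congr fun i => ?_
        rw [parseval_ennreal c]
        refine tsum_congr fun k => ?_
        rw [← hsymm, ← norm_inner_symm]

/-- A density operator (statistical operator): a positive bounded operator of trace one. -/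
def IsDensityOperator (T : H →L[ℂ] H) : Prop :=
  T.IsPositive ∧ posTrace T = 1

/-- The eigenspace `{x | T x = s x}` of `T` for the real number `s` (`⊥` unless `s` is an
eigenvalue). -/
def eigSpace (T : H →L[ℂ] H) (s : ℝ) : Submodule ℂ H :=
  Module.End.eigenspace (T : H →ₗ[ℂ] H) (s : ℂ)

theorem mem_eigSpace {T : H →L[ℂ] H} {s : ℝ} {x : H} :
    x ∈ eigSpace T s ↔ T x = (s : ℂ) • x := by
  simp [eigSpace]

theorem isClosed_eigSpace (T : H →L[ℂ] H) (s : ℝ) : IsClosed (eigSpace T s : Set H) := by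
  have h : (eigSpace T s : Set H) = {x | T x = (s : ℂ) • x} := by
    ext x
    exact mem_eigSpace
  rw [h]
  exact isClosed_eq T.continuous (continuous_const_smul _)

instance (T : H →L[ℂ] H) (s : ℝ) : CompleteSpace (eigSpace T s) :=
  (isClosed_eigSpace T s).completeSpace_coe

/-- The eigenprojection of `T` for `s`: the orthogonal projection onto the eigenspace. -/
def eigProj (T : H →L[ℂ] H) (s : ℝ) : H →L[ℂ] H :=
  (eigSpace T s).starProjection

/-- The number `-log s` in `[0, ∞]` for `0 ≤ s ≤ 1`, with `-log 0 = ∞`. (It is used only for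
eigenvalues of density operators, which lie in `[0, 1]`.) -/
def negLog (s : ℝ) : ℝ≥0∞ :=
  if s ≤ 0 then ∞ else ENNReal.ofReal (-Real.log s)

/-- `-Tr (A log σ)` in `[0, ∞]`, for a density operator `σ` and a positive trace-class operator `A`:
with the spectral decomposition `σ = ∑ s, s • Q s` (pure point, as `σ` is compact), the possibly
unbounded operator `-log σ ≥ 0` has the eigenprojections `Q s` and the eigenvalues `-log s`, so that
`-Tr (A log σ) = ∑ s, (-log s) * Tr (A (Q s))`, where `Tr (A (Q s)) = Tr (Q s ∘ A ∘ Q s)`. An `s`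
that is no eigenvalue of `σ` contributes nothing because `Q s = 0` (and `∞ * 0 = 0`). -/
def negTraceMulLog (A σ : H →L[ℂ] H) : ℝ≥0∞ :=
  ∑' s : ℝ, negLog s * posTrace (eigProj σ s ∘L A ∘L eigProj σ s)

/-- `Tr (A log σ)` in `[-∞, 0]`. -/
def traceMulLog (A σ : H →L[ℂ] H) : EReal :=
  -(negTraceMulLog A σ : EReal)

/-- The block `P r ∘ ρ ∘ P r` of `ρ`, where `P r` is the eigenprojection of `ρ` for `r`. -/
def block (ρ : H →L[ℂ] H) (r : ℝ) : H →L[ℂ] H :=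
  eigProj ρ r ∘L ρ ∘L eigProj ρ r

/-- The trace of `ρ log ρ - ρ log σ` restricted to the eigenspace of `ρ` for `r`. -/
def blockRelEntropy (ρ σ : H →L[ℂ] H) (r : ℝ) : EReal :=
  traceMulLog (block ρ r) ρ - traceMulLog (block ρ r) σ

/-- The sum of the positive parts of a family of extended real numbers. -/
def posPartSum {ι : Type*} (f : ι → EReal) : ℝ≥0∞ := ∑' i, (f i).toENNReal

/-- The sum of the negative parts of a family of extended real numbers. -/
def negPartSum {ι : Type*} (f : ι → EReal) : ℝ≥0∞ := ∑' i, (-f i).toENNReal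

/-- The unconditional sum of a family of extended real numbers; meaningful if the positive parts or
the negative parts have a finite sum. -/
def extSum {ι : Type*} (f : ι → EReal) : EReal :=
  (posPartSum f : EReal) - (negPartSum f : EReal)

open scoped Classical in
/-- The relative entropy `S(ρ‖σ) = Tr (ρ log ρ) - Tr (ρ log σ)` in `[-∞, ∞]`. If both traces are
`-∞`, so that their difference has no meaning, `S(ρ‖σ)` is the trace of `ρ log ρ - ρ log σ`, taken
block by block along the eigenspaces of `ρ`. -/
def relEntropy (ρ σ : H →L[ℂ] H) : EReal :=
  if traceMulLog ρ ρ = ⊥ ∧ traceMulLog ρ σ = ⊥ then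
    extSum (blockRelEntropy ρ σ)
  else
    traceMulLog ρ ρ - traceMulLog ρ σ

end QuantumEntropy

end

/-! A positive T of finite trace is compact because √T is Hilbert-Schmidt, so ρ and σ have
eigenbases (e i, a i) and (f j, b j). With the overlaps w i j = |⟪e i, f j⟫|², -Tr(ρ log σ) becomes
∑ a i * w i j * (-log b j), and -Tr(ρ log ρ) becomes ∑ a i * (-log a i) (`negTraceMulLog_eq_tsum`,
`IsEigenbasis.negTraceMulLog_eq`). Averaging a(-log a) + a ≤ a(-log b) + b over j with weights w i j
gives an inequality for each i. Summed over all i, the linear terms are Tr ρ = Tr σ = 1 and cancel.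
Summed over a i = r, it gives X r + α r ≤ Y r + γ r with ∑ α = ∑ γ = 1: hence (X - Y)⁺ ≤ γ, which
has finite sum, and the negative parts sum to at most the positive parts. All sums are kept in [0,
∞], so they may be interchanged freely. -/

open scoped ENNReal InnerProductSpace

namespace QuantumEntropy

universe u

/-! ### Eigenbases of trace-class operators and traces computed in them. -/

section Eigenbasis

variable {H : Type*} [NormedAddCommGroup H] [InnerProductSpace ℂ H] [CompleteSpace H]

/-- An orthonormal Hilbert basis consisting of eigenvectors of `T`, with real eigenvalues `a`. -/
def IsEigenbasis {ι : Type*} (T : H →L[ℂ] H) (e : HilbertBasis ι ℂ H) (a : ι → ℝ) : Prop :=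
  ∀ i, T (e i) = (a i : ℂ) • e i

/-- A symmetric Hilbert-Schmidt operator is compact. -/
theorem isCompactOperator_of_summable_norm_sq {ι : Type*} (b : HilbertBasis ι ℂ H)
    {S : H →L[ℂ] H} (hsymm : ∀ x y, ⟪S x, y⟫_ℂ = ⟪x, S y⟫_ℂ)
    (hS : Summable fun i => ‖S (b i)‖ ^ 2) : IsCompactOperator S := by
  classical
  -- By symmetry, `F s` is S followed by the projection onto the span of the `b i` with i ∈ s.
  let F : Finset ι → H →L[ℂ] H := fun s =>
    ∑ i ∈ s, (innerSL ℂ (S (b i))).smulRight (b i)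
  have hF : ∀ s x, F s x = ∑ i ∈ s, ⟪b i, S x⟫_ℂ • b i := by
    intro s x
    simp [F, hsymm]
  have hcoef : ∀ s x j, ⟪b j, S x - F s x⟫_ℂ = if j ∈ s then 0 else ⟪b j, S x⟫_ℂ := by
    intro s x j
    rw [inner_sub_right, hF, inner_sum]
    simp only [inner_smul_right, orthonormal_iff_ite.mp b.orthonormal, mul_ite, mul_one, mul_zero,
      Finset.sum_ite_eq]
    split_ifs <;> simp
  have hcomp : ∀ s, IsCompactOperator (F s) := by
    intro s
    refine Submodule.sum_mem (compactOperator (RingHom.id ℂ) H H) (fun i _ => ?_)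
    have h1 : IsCompactOperator (innerSL ℂ (S (b i)) : H →L[ℂ] ℂ) :=
      isCompactOperator_id.comp_clm (innerSL ℂ (S (b i)))
    exact h1.clm_comp ((ContinuousLinearMap.id ℂ ℂ).smulRight (b i))
  refine isCompactOperator_of_tendsto (l := Filter.atTop) (F := F) ?_
    (Filter.Eventually.of_forall hcomp)
  -- Parseval leaves the coefficients ⟪b i, S x⟫ = ⟪S (b i), x⟫ with i ∉ s; Cauchy-Schwarz bounds
  -- each.
  have hbound : ∀ s, ‖S - F s‖ ≤ √(∑' i : {i // i ∉ s}, ‖S (b i)‖ ^ 2) := by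
    intro s
    refine ContinuousLinearMap.opNorm_le_bound _ (Real.sqrt_nonneg _) fun x => ?_
    have hs : Summable fun i : {i // i ∉ s} => ‖S (b i)‖ ^ 2 := hS.subtype _
    have h0 : (0 : ℝ) ≤ ∑' i : {i // i ∉ s}, ‖S (b i)‖ ^ 2 := tsum_nonneg fun _ => by positivity
    rw [← abs_of_nonneg (norm_nonneg x), ← Real.sqrt_sq_eq_abs, ← Real.sqrt_mul h0]
    refine Real.le_sqrt_of_sq_le ?_
    rw [← ENNReal.ofReal_le_ofReal_iff (by positivity), parseval_ennreal b,
      ← tsum_mul_right, ENNReal.ofReal_tsum_of_nonneg (fun _ => by positivity)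
        (hs.mul_right _)]
    rw [← tsum_subtype_eq_of_support_subset (s := {i | i ∉ s})]
    · refine ENNReal.tsum_le_tsum fun i => ENNReal.ofReal_le_ofReal ?_
      rw [sub_apply, hcoef, if_neg i.2, ← hsymm, ← mul_pow]
      exact pow_le_pow_left₀ (norm_nonneg _) (norm_inner_le_norm _ _) 2
    · intro i hi
      by_contra h
      apply hi
      have : i ∈ s := by simpa using h
      simp [hcoef, this]
  have hlim : Filter.Tendsto (fun s : Finset ι => √(∑' i : {i // i ∉ s}, ‖S (b i)‖ ^ 2))
      Filter.atTop (nhds 0) := by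
    have := (tendsto_tsum_compl_atTop_zero fun i => ‖S (b i)‖ ^ 2).sqrt
    simpa using this
  rw [tendsto_iff_norm_sub_tendsto_zero]
  refine squeeze_zero (fun _ => norm_nonneg _) (fun s => ?_) hlim
  rw [norm_sub_rev]
  exact hbound s

/-- A positive operator of finite trace is compact. -/
theorem isCompactOperator_of_posTrace_ne_top {T : H →L[ℂ] H} (hT : T.IsPositive)
    (htr : posTrace T ≠ ∞) : IsCompactOperator T := by
  obtain ⟨w, b, -⟩ := exists_hilbertBasis ℂ H
  have hT0 : 0 ≤ T := (ContinuousLinearMap.nonneg_iff_isPositive T).2 hT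
  have hS : (CFC.sqrt T).IsPositive :=
    (ContinuousLinearMap.nonneg_iff_isPositive _).1 (CFC.sqrt_nonneg T)
  have hmul : CFC.sqrt T * CFC.sqrt T = T := CFC.sqrt_mul_sqrt_self T hT0
  have hsymm : ∀ x y, ⟪CFC.sqrt T x, y⟫_ℂ = ⟪x, CFC.sqrt T y⟫_ℂ :=
    fun x y => hS.inner_left_eq_inner_right x y
  have hdiag : ∀ x, RCLike.re ⟪x, T x⟫_ℂ = ‖CFC.sqrt T x‖ ^ 2 := by
    intro x
    conv_lhs => rw [← hmul]
    rw [mul_apply_eq_comp, ← hsymm, inner_self_eq_norm_sq]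
  rw [posTrace_eq b hT] at htr
  have hsum : Summable fun i => ‖CFC.sqrt T (b i)‖ ^ 2 := by
    have h := ENNReal.summable_toReal htr
    refine h.congr fun i => ?_
    rw [hdiag, ENNReal.toReal_ofReal (by positivity)]
  have hc := isCompactOperator_of_summable_norm_sq b hsymm hsum
  have := hc.comp_clm (CFC.sqrt T)
  rw [← hmul]
  exact this

/-- A positive operator of finite trace has an eigenbasis. -/
theorem exists_isEigenbasis {H : Type u} [NormedAddCommGroup H] [InnerProductSpace ℂ H]
    [CompleteSpace H] {T : H →L[ℂ] H} (hT : T.IsPositive) (htr : posTrace T ≠ ∞) :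
    ∃ (ι : Type u) (e : HilbertBasis ι ℂ H) (a : ι → ℝ), IsEigenbasis T e a := by
  have hc := isCompactOperator_of_posTrace_ne_top hT htr
  have hsymm : (T : H →ₗ[ℂ] H).IsSymmetric := hT.isSymmetric
  have hbot := ContinuousLinearMap.orthogonalComplement_iSup_eigenspaces_eq_bot hc hsymm
  let E : ℂ → Submodule ℂ H := fun μ => Module.End.eigenspace (T : H →ₗ[ℂ] H) μ
  have hclosed : ∀ μ, CompleteSpace (E μ) := fun μ => by
    have h : (E μ : Set H) = {x | T x = μ • x} := by
      ext x
      simp [E]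
    have h' : IsClosed (E μ : Set H) := by
      rw [h]
      exact isClosed_eq T.continuous (continuous_const_smul _)
    exact h'.completeSpace_coe
  choose w d hd using fun μ => exists_hilbertBasis ℂ (E μ)
  have hon : Orthonormal ℂ fun p : Σ μ, w μ => ((d p.1 p.2 : E p.1) : H) :=
    hsymm.orthogonalFamily_eigenspaces.orthonormal_sigma_orthonormal fun μ => (d μ).orthonormal
  -- A vector orthogonal to the bases of all eigenspaces projects to 0 in each, hence vanishes by
  -- the spectral theorem `hbot`.
  have hspan : (Submodule.span ℂ (Set.range fun p : Σ μ, w μ => ((d p.1 p.2 : E p.1) : H)))ᗮ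
      = ⊥ := by
    rw [eq_bot_iff, ← hbot]
    intro x hx
    rw [Submodule.mem_orthogonal] at hx
    rw [← Submodule.iInf_orthogonal, Submodule.mem_iInf]
    intro μ
    have hx0 : (E μ).orthogonalProjectionOnto x = 0 := by
      have h : ENNReal.ofReal (‖(E μ).orthogonalProjectionOnto x‖ ^ 2) = 0 := by
        rw [parseval_ennreal (d μ), ENNReal.tsum_eq_zero]
        intro k
        rw [Submodule.inner_orthogonalProjectionOnto_eq_of_mem_left,
          hx _ (Submodule.subset_span ⟨⟨μ, k⟩, rfl⟩)]
        simp
      exact norm_eq_zero.1 (pow_eq_zero_iff two_ne_zero |>.1 (le_antisymm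
        (ENNReal.ofReal_eq_zero.1 h) (by positivity)))
    exact Submodule.orthogonalProjectionOnto_eq_zero_iff.1 hx0
  let e := HilbertBasis.mkOfOrthogonalEqBot hon hspan
  have he : ∀ p, e p = (d p.1 p.2 : H) := fun p => by
    simp only [e, HilbertBasis.coe_mkOfOrthogonalEqBot]
  refine ⟨Σ μ, w μ, e, fun p => p.1.re, fun p => ?_⟩
  have hmem : T (e p) = p.1 • e p := by
    rw [he]
    exact Module.End.mem_eigenspace_iff.1 (d p.1 p.2).2
  have hne : e p ≠ 0 := e.orthonormal.ne_zero p
  have hreal : (starRingEnd ℂ) p.1 = p.1 :=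
    hsymm.conj_eigenvalue_eq_self (Module.End.hasEigenvalue_of_hasEigenvector
      (x := e p) ⟨Module.End.mem_eigenspace_iff.2 hmem, hne⟩)
  rw [hmem, Complex.conj_eq_iff_re.1 hreal]

namespace IsEigenbasis

variable {ι : Type*} {T : H →L[ℂ] H} {e : HilbertBasis ι ℂ H} {a : ι → ℝ}

theorem re_inner_self (he : IsEigenbasis T e a) (i : ι) : RCLike.re ⟪e i, T (e i)⟫_ℂ = a i := by
  rw [he i, inner_smul_right, inner_self_eq_norm_sq_to_K, e.orthonormal.1 i]
  simp

theorem nonneg (he : IsEigenbasis T e a) (hT : T.IsPositive) (i : ι) : 0 ≤ a i := by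
  rw [← he.re_inner_self i]
  exact hT.re_inner_nonneg_right _

theorem posTrace_eq_tsum (he : IsEigenbasis T e a) (hT : T.IsPositive) :
    posTrace T = ∑' i, ENNReal.ofReal (a i) := by
  rw [posTrace_eq e hT]
  exact tsum_congr fun i => by rw [he.re_inner_self]

theorem le_one (he : IsEigenbasis T e a) (hT : IsDensityOperator T) (i : ι) : a i ≤ 1 := by
  have h := ENNReal.le_tsum (f := fun i => ENNReal.ofReal (a i)) i
  rw [← he.posTrace_eq_tsum hT.1, hT.2] at h
  exact ENNReal.ofReal_le_one.1 h

theorem ofReal_re_inner (he : IsEigenbasis T e a) (hT : T.IsPositive) (x : H) :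
    ENNReal.ofReal (RCLike.re ⟪x, T x⟫_ℂ) =
      ∑' i, ENNReal.ofReal (a i) * ENNReal.ofReal (‖⟪e i, x⟫_ℂ‖ ^ 2) := by
  have h : HasSum (fun i => a i * ‖⟪e i, x⟫_ℂ‖ ^ 2) (RCLike.re ⟪x, T x⟫_ℂ) := by
    have h1 := Complex.hasSum_re (e.hasSum_inner_mul_inner x (T x))
    refine h1.congr_fun fun i => ?_
    rw [← hT.inner_left_eq_inner_right, he i, inner_smul_left, Complex.conj_ofReal,
      ← inner_conj_symm x (e i)]
    rw [mul_left_comm, Complex.conj_mul', ← Complex.ofReal_pow, ← Complex.ofReal_mul,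
      Complex.ofReal_re]
  rw [← h.tsum_eq, ENNReal.ofReal_tsum_of_nonneg
    (fun i => mul_nonneg (he.nonneg hT i) (by positivity)) h.summable]
  exact tsum_congr fun i => ENNReal.ofReal_mul (he.nonneg hT i)

open scoped Classical in
theorem eigProj_apply (he : IsEigenbasis T e a) (hT : T.IsPositive) (s : ℝ) (i : ι) :
    eigProj T s (e i) = if a i = s then e i else 0 := by
  split_ifs with h
  · exact Submodule.starProjection_eq_self_iff.2 (mem_eigSpace.2 (h ▸ he i))
  · refine (Submodule.starProjection_apply_eq_zero_iff _).2 fun y hy => ?_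
    rw [mem_eigSpace] at hy
    have h1 := hT.inner_left_eq_inner_right y (e i)
    rw [hy, he i, inner_smul_left, inner_smul_right, Complex.conj_ofReal] at h1
    by_contra h0
    exact h (Complex.ofReal_injective (mul_right_cancel₀ h0 h1)).symm

-- The basis `e` diagonalizes every block of T as well, so the trace formulas apply to blocks.
open scoped Classical in
theorem block (he : IsEigenbasis T e a) (hT : T.IsPositive) (r : ℝ) :
    IsEigenbasis (block T r) e fun i => if a i = r then a i else 0 := by
  intro i
  simp only [QuantumEntropy.block, ContinuousLinearMap.comp_apply, he.eigProj_apply hT]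
  split_ifs with h
  · rw [he i, map_smul, he.eigProj_apply hT, if_pos h]
  · simp

open scoped Classical in
/-- `-Tr (A log σ)` in an eigenbasis of `σ`. -/
theorem negTraceMulLog_eq (he : IsEigenbasis T e a) (hT : T.IsPositive) {A : H →L[ℂ] H}
    (hA : A.IsPositive) :
    negTraceMulLog A T =
      ∑' i, negLog (a i) * ENNReal.ofReal (RCLike.re ⟪e i, A (e i)⟫_ℂ) := by
  have htr : ∀ s, posTrace (eigProj T s ∘L A ∘L eigProj T s) =
      ∑' i, if s = a i then ENNReal.ofReal (RCLike.re ⟪e i, A (e i)⟫_ℂ) else 0 := by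
    intro s
    have hpos : (eigProj T s ∘L A ∘L eigProj T s).IsPositive := hA.conj_starProjection _
    rw [posTrace_eq e hpos]
    refine tsum_congr fun i => ?_
    have h1 : ⟪e i, (eigProj T s ∘L A ∘L eigProj T s) (e i)⟫_ℂ =
        ⟪eigProj T s (e i), A (eigProj T s (e i))⟫_ℂ :=
      (Submodule.inner_starProjection_left_eq_right _ _ _).symm
    rw [h1, he.eigProj_apply hT]
    by_cases h : a i = s
    · simp [h]
    · simp [h, Ne.symm h]
  unfold negTraceMulLog
  simp only [htr, ← ENNReal.tsum_mul_left, mul_ite, mul_zero]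
  rw [ENNReal.tsum_comm]
  exact tsum_congr fun i => tsum_ite_eq (a i) _

end IsEigenbasis

theorem isPositive_block {T : H →L[ℂ] H} (hT : T.IsPositive) (r : ℝ) : (block T r).IsPositive :=
  hT.conj_starProjection _

/-- `-Tr (A log σ)` in terms of eigenbases of `A` and of `σ`. -/
theorem negTraceMulLog_eq_tsum {ι κ : Type*} {A σ : H →L[ℂ] H} {e : HilbertBasis ι ℂ H}
    {f : HilbertBasis κ ℂ H} {a : ι → ℝ} {b : κ → ℝ} (he : IsEigenbasis A e a)
    (hf : IsEigenbasis σ f b) (hA : A.IsPositive) (hσ : σ.IsPositive) :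
    negTraceMulLog A σ = ∑' i, ENNReal.ofReal (a i) *
      ∑' j, ENNReal.ofReal (‖⟪e i, f j⟫_ℂ‖ ^ 2) * negLog (b j) := by
  rw [hf.negTraceMulLog_eq hσ hA]
  simp only [he.ofReal_re_inner hA, ← ENNReal.tsum_mul_left]
  rw [ENNReal.tsum_comm]
  exact tsum_congr fun i => tsum_congr fun j => by ring

end Eigenbasis

/-! ### The scalar inequality and truncated subtraction. -/

section Scalar

/-- Convexity of `x log x`, in the form `a log b + a ≤ a log a + b`. -/
theorem ofReal_mul_negLog_add_le {a b : ℝ} (ha : 0 ≤ a) (ha1 : a ≤ 1) (hb : 0 ≤ b) (hb1 : b ≤ 1) :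
    ENNReal.ofReal a * negLog a + ENNReal.ofReal a ≤
      ENNReal.ofReal a * negLog b + ENNReal.ofReal b := by
  rcases ha.eq_or_lt with rfl | ha
  · simp
  rcases hb.eq_or_lt with rfl | hb
  · simp [negLog, ENNReal.mul_top, ha]
  rw [negLog, negLog, if_neg ha.not_ge, if_neg hb.not_ge, ← ENNReal.ofReal_mul ha.le,
    ← ENNReal.ofReal_mul ha.le]
  have hla := Real.log_nonpos ha.le ha1
  have hlb := Real.log_nonpos hb.le hb1
  rw [← ENNReal.ofReal_add (mul_nonneg ha.le (by linarith)) ha.le,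
    ← ENNReal.ofReal_add (mul_nonneg ha.le (by linarith)) hb.le]
  refine ENNReal.ofReal_le_ofReal ?_
  -- This is log t ≤ t - 1 at t = b / a, multiplied by a.
  have h := mul_le_mul_of_nonneg_left (Real.log_le_sub_one_of_pos (div_pos hb ha)) ha.le
  rw [Real.log_div hb.ne' ha.ne', mul_sub, mul_sub, mul_div_cancel₀ _ ha.ne'] at h
  linarith

theorem toENNReal_neg_sub_neg (x y : ℝ≥0∞) :
    (-(x : EReal) - -(y : EReal)).toENNReal = y - x := by
  rw [sub_eq_add_neg, neg_neg, add_comm, ← sub_eq_add_neg,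
    EReal.toENNReal_sub (EReal.coe_ennreal_nonneg x)]
  simp

/-- Fails at x = y = ∞, where the left side is ∞ and the right side is 0. -/
theorem toENNReal_neg_neg_sub_neg {x : ℝ≥0∞} (hx : x ≠ ∞) (y : ℝ≥0∞) :
    (-(-(x : EReal) - -(y : EReal))).toENNReal = x - y := by
  have h : -(-(x : EReal) - -(y : EReal)) = (x : EReal) - y := by
    lift x to NNReal using hx
    rw [EReal.neg_sub, neg_neg, sub_eq_add_neg]
    · left
      simp
    · left
      simp
  rw [h, EReal.toENNReal_sub (EReal.coe_ennreal_nonneg y)]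
  simp

theorem tsub_add_le_tsub_add {x y a c : ℝ≥0∞} (hx : x ≠ ∞) (h : x + a ≤ y + c) :
    x - y + a ≤ y - x + c := by
  rcases le_total x y with hxy | hxy
  · rw [tsub_eq_zero_of_le hxy, zero_add, ← ENNReal.add_le_add_iff_left hx, ← add_assoc,
      add_tsub_cancel_of_le hxy]
    exact h
  · have hy : y ≠ ∞ := ne_top_of_le_ne_top hx hxy
    rw [tsub_eq_zero_of_le hxy, zero_add, ← ENNReal.add_le_add_iff_left hy, ← add_assoc,
      add_tsub_cancel_of_le hxy]
    exact h

end Scalar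

/-! ### Klein's inequality, globally and block by block. -/

section Klein

variable {H : Type*} [NormedAddCommGroup H] [InnerProductSpace ℂ H] [CompleteSpace H]
  {ι κ : Type*} {ρ σ : H →L[ℂ] H} {e : HilbertBasis ι ℂ H} {f : HilbertBasis κ ℂ H}
  {a : ι → ℝ} {b : κ → ℝ}

/-- The convexity inequality on the ray of a single eigenvector of `ρ`. -/
theorem IsEigenbasis.ofReal_mul_negLog_add_le (he : IsEigenbasis ρ e a) (hf : IsEigenbasis σ f b)
    (hρ : IsDensityOperator ρ) (hσ : IsDensityOperator σ) (i : ι) :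
    ENNReal.ofReal (a i) * negLog (a i) + ENNReal.ofReal (a i) ≤
      ENNReal.ofReal (a i) * ∑' j, ENNReal.ofReal (‖⟪e i, f j⟫_ℂ‖ ^ 2) * negLog (b j) +
        ∑' j, ENNReal.ofReal (‖⟪e i, f j⟫_ℂ‖ ^ 2) * ENNReal.ofReal (b j) := by
  have h1 : ∑' j, ENNReal.ofReal (‖⟪e i, f j⟫_ℂ‖ ^ 2) = 1 := by
    have h := parseval_ennreal f (e i)
    rw [e.orthonormal.1 i, one_pow, ENNReal.ofReal_one] at h
    rw [h]
    exact tsum_congr fun j => by rw [norm_inner_symm]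
  calc ENNReal.ofReal (a i) * negLog (a i) + ENNReal.ofReal (a i)
      = ∑' j, ENNReal.ofReal (‖⟪e i, f j⟫_ℂ‖ ^ 2) *
          (ENNReal.ofReal (a i) * negLog (a i) + ENNReal.ofReal (a i)) := by
        rw [ENNReal.tsum_mul_right, h1, one_mul]
    _ ≤ ∑' j, ENNReal.ofReal (‖⟪e i, f j⟫_ℂ‖ ^ 2) *
          (ENNReal.ofReal (a i) * negLog (b j) + ENNReal.ofReal (b j)) :=
        ENNReal.tsum_le_tsum fun j => mul_le_mul_right
          (QuantumEntropy.ofReal_mul_negLog_add_le (he.nonneg hρ.1 i) (he.le_one hρ i)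
            (hf.nonneg hσ.1 j) (hf.le_one hσ j)) _
    _ = _ := by
        rw [← ENNReal.tsum_mul_left, ← ENNReal.tsum_add]
        exact tsum_congr fun j => by ring

/-- The inner sum is ⟪e i, σ (e i)⟫, so this is Tr σ computed in the basis `e`. -/
theorem tsum_tsum_overlap_mul_eq_one (e : HilbertBasis ι ℂ H) (hf : IsEigenbasis σ f b)
    (hσ : IsDensityOperator σ) :
    ∑' i, ∑' j, ENNReal.ofReal (‖⟪e i, f j⟫_ℂ‖ ^ 2) * ENNReal.ofReal (b j) = 1 := by
  rw [← hσ.2, posTrace_eq e hσ.1]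
  refine tsum_congr fun i => ?_
  rw [hf.ofReal_re_inner hσ.1]
  exact tsum_congr fun j => by rw [norm_inner_symm, mul_comm]

theorem negTraceMulLog_self_le (hρ : IsDensityOperator ρ) (hσ : IsDensityOperator σ) :
    negTraceMulLog ρ ρ ≤ negTraceMulLog ρ σ := by
  obtain ⟨ι, e, a, he⟩ := exists_isEigenbasis hρ.1 (by simp [hρ.2])
  obtain ⟨κ, f, b, hf⟩ := exists_isEigenbasis hσ.1 (by simp [hσ.2])
  have h := ENNReal.tsum_le_tsum fun i => he.ofReal_mul_negLog_add_le hf hρ hσ i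
  rw [ENNReal.tsum_add, ENNReal.tsum_add, tsum_tsum_overlap_mul_eq_one e hf hσ,
    ← he.posTrace_eq_tsum hρ.1, hρ.2, ← negTraceMulLog_eq_tsum he hf hρ.1 hσ.1] at h
  rw [he.negTraceMulLog_eq hρ.1 hρ.1]
  simp only [he.re_inner_self, mul_comm (negLog _)]
  exact (ENNReal.add_le_add_iff_right ENNReal.one_ne_top).1 h

/-- On one block the logarithm is the constant log r, and the trace of the block is at most 1. -/
theorem negTraceMulLog_block_self_ne_top (hρ : IsDensityOperator ρ) (r : ℝ) :
    negTraceMulLog (block ρ r) ρ ≠ ∞ := by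
  classical
  obtain ⟨ι, e, a, he⟩ := exists_isEigenbasis hρ.1 (by simp [hρ.2])
  rw [he.negTraceMulLog_eq hρ.1 (isPositive_block hρ.1 r)]
  simp only [(he.block hρ.1 r).re_inner_self]
  have h1 : ∀ i, negLog (a i) * ENNReal.ofReal (if a i = r then a i else 0) ≤
      ENNReal.ofReal (-Real.log r) * ENNReal.ofReal (a i) := by
    intro i
    split_ifs with h
    · rw [h, negLog]
      split_ifs with h0
      -- Here ∞ * 0 = 0 absorbs log 0.
      · simp [ENNReal.ofReal_of_nonpos h0]
      · exact le_rfl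
    · simp
  refine ne_top_of_le_ne_top ?_ (ENNReal.tsum_le_tsum h1)
  rw [ENNReal.tsum_mul_left, ← he.posTrace_eq_tsum hρ.1, hρ.2, mul_one]
  exact ENNReal.ofReal_ne_top

/-- Klein's inequality on the eigenspaces of `ρ`, with the traces `α r` and `γ r` of the blocks of
`ρ` and `σ`. -/
theorem exists_negTraceMulLog_block_add_le (hρ : IsDensityOperator ρ) (hσ : IsDensityOperator σ) :
    ∃ α γ : ℝ → ℝ≥0∞, ∑' r, α r = 1 ∧ ∑' r, γ r = 1 ∧ ∀ r,
      negTraceMulLog (block ρ r) ρ + α r ≤ negTraceMulLog (block ρ r) σ + γ r := by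
  classical
  obtain ⟨ι, e, a, he⟩ := exists_isEigenbasis hρ.1 (by simp [hρ.2])
  obtain ⟨κ, f, b, hf⟩ := exists_isEigenbasis hσ.1 (by simp [hσ.2])
  have hsum : ∀ g : ι → ℝ≥0∞, ∑' r, ∑' i, (if r = a i then g i else 0) = ∑' i, g i := by
    intro g
    rw [ENNReal.tsum_comm]
    exact tsum_congr fun i => tsum_ite_eq (a i) _
  refine ⟨fun r => ∑' i, if r = a i then ENNReal.ofReal (a i) else 0, fun r => ∑' i, if r = a i then
    ∑' j, ENNReal.ofReal (‖⟪e i, f j⟫_ℂ‖ ^ 2) * ENNReal.ofReal (b j) else 0, ?_, ?_, fun r => ?_⟩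
  · rw [hsum, ← he.posTrace_eq_tsum hρ.1, hρ.2]
  · rw [hsum, tsum_tsum_overlap_mul_eq_one e hf hσ]
  · rw [he.negTraceMulLog_eq hρ.1 (isPositive_block hρ.1 r),
      negTraceMulLog_eq_tsum (he.block hρ.1 r) hf (isPositive_block hρ.1 r) hσ.1,
      ← ENNReal.tsum_add, ← ENNReal.tsum_add]
    refine ENNReal.tsum_le_tsum fun i => ?_
    rw [(he.block hρ.1 r).re_inner_self]
    by_cases h : a i = r
    · rw [if_pos h, if_pos h.symm, if_pos h.symm, mul_comm (negLog _)]
      exact he.ofReal_mul_negLog_add_le hf hρ hσ i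
    · simp [h, Ne.symm h]

theorem negPartSum_blockRelEntropy (hρ : IsDensityOperator ρ) (hσ : IsDensityOperator σ) :
    negPartSum (blockRelEntropy ρ σ) ≠ ∞ ∧
      negPartSum (blockRelEntropy ρ σ) ≤ posPartSum (blockRelEntropy ρ σ) := by
  obtain ⟨α, γ, hα, hγ, h⟩ := exists_negTraceMulLog_block_add_le hρ hσ
  have hX := negTraceMulLog_block_self_ne_top hρ
  have hpos : posPartSum (blockRelEntropy ρ σ) =
      ∑' r, (negTraceMulLog (block ρ r) σ - negTraceMulLog (block ρ r) ρ) :=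
    tsum_congr fun r => toENNReal_neg_sub_neg _ _
  have hneg : negPartSum (blockRelEntropy ρ σ) =
      ∑' r, (negTraceMulLog (block ρ r) ρ - negTraceMulLog (block ρ r) σ) :=
    tsum_congr fun r => toENNReal_neg_neg_sub_neg (hX r) _
  rw [hpos, hneg]
  constructor
  · refine ne_top_of_le_ne_top (hγ ▸ ENNReal.one_ne_top) (ENNReal.tsum_le_tsum fun r => ?_)
    exact tsub_le_iff_left.2 (le_self_add.trans (h r))
  · have h' := ENNReal.tsum_le_tsum fun r => tsub_add_le_tsub_add (hX r) (h r)
    rw [ENNReal.tsum_add, ENNReal.tsum_add, hα, hγ] at h'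
    exact (ENNReal.add_le_add_iff_right ENNReal.one_ne_top).1 h'

end Klein

end QuantumEntropy

theorem proposition4 {H : Type*} [NormedAddCommGroup H] [InnerProductSpace ℂ H] [CompleteSpace H]
    (ρ σ : H →L[ℂ] H) (hρ : QuantumEntropy.IsDensityOperator ρ)
    (hσ : QuantumEntropy.IsDensityOperator σ) :
    QuantumEntropy.negPartSum (QuantumEntropy.blockRelEntropy ρ σ) ≠ ⊤ ∧
      0 ≤ QuantumEntropy.relEntropy ρ σ := by
  obtain ⟨hfin, hle⟩ := QuantumEntropy.negPartSum_blockRelEntropy hρ hσ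
  refine ⟨hfin, ?_⟩
  rw [QuantumEntropy.relEntropy]
  split_ifs with h
  · refine (EReal.sub_nonneg (Or.inr ?_) (Or.inr (EReal.coe_ennreal_ne_bot _))).2
      (EReal.coe_ennreal_le_coe_ennreal_iff.2 hle)
    exact mt EReal.coe_ennreal_eq_top_iff.1 hfin
  -- The branch condition `h` rules out ⊥ - ⊥; neither trace can be ⊤.
  · refine (EReal.sub_nonneg (Or.inl ?_) (not_and_or.1 h)).2 (EReal.neg_le_neg_iff.2
      (EReal.coe_ennreal_le_coe_ennreal_iff.2 (QuantumEntropy.negTraceMulLog_self_le hρ hσ)))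
    exact mt EReal.neg_eq_top_iff.1 (EReal.coe_ennreal_ne_bot _)
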